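/- Let $\mathbb K$ be $\mathbb R$ or $\mathbb C$, and let $X$ be the set of positive definite (real symmetric, resp. complex Hermitian) $m\times m$ matrices over $\mathbb K$, equipped with the Riemannian trace metric $\langle H,K\rangle_P=\operatorname{tr}(P^{-1}HP^{-1}K)$. Let $d(A,B)$ be the corresponding length distance, i.e. the infimum of the lengths $\int_0^1\langle\gamma'(t),\gamma'(t)\rangle_{\gamma(t)}^{1/2}\,dt$ over the $C^1$ curves $\gamma:[0,1]\to X$ from $A$ to $B$. Then: (1) $d$ is a complete metric on $X$, and any $A,B\in X$ have exactly one metric midpoint, i.e. exactly one $M\in X$ with $d(M,A)=d(M,B)=\frac12 d(A,B)$; it is the geometric mean $A\#B=A^{1/2}(A^{-1/2}BA^{-1/2})^{1/2}A^{1/2}$. (2) The operation $\#$ is a convex $2$-mean on $(X,d)$: $A\#A=A$, $A\#B=B\#A$, and $d(A\#C,B\#C)\le\frac12 d(A,B)$ for all $A,B,C\in X$. (3) The mean $\#$ inductively $\beta$-extends to an $n$-mean for each $n>2$. Here an $n$-mean is a map $\mu:X^n\to X$ with $\mu(x,\dots,x)=x$ for all $x$. For a $k$-mean $\mu$, let $\beta_\mu:X^{k+1}\to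 X^{k+1}$ be the map whose $j$-th coordinate at $\mathbf x$ is $\mu$ applied to the $k$-tuple obtained from $\mathbf x$ by deleting its $j$-th entry. A $(k+1)$-mean $\nu$ is a $\beta$-extension of a continuous $k$-mean $\mu$ if $\lim_N\beta_\mu^N(\mathbf x)=(\nu(\mathbf x),\dots,\nu(\mathbf x))$ for every $\mathbf x\in X^{k+1}$. That is, there is exactly one family $(\mu_n)_{n\ge2}$ of means $\mu_n:X^n\to X$ such that $\mu_2=\#$ and, for all $n\ge 2$, $\mu_n$ is continuous and $\mu_{n+1}$ is a $\beta$-extension of $\mu_n$. Moreover every $\mu_n$ is symmetric (invariant under permutations of its arguments), nonexpansive ($d(\mu_n(\mathbf x),\mu_n(\mathbf y))\le\max_j d(x_j,y_j)$), and coordinatewise $\frac12$-contractive ($d(\mu_n(\mathbf x),\mu_n(\mathbf y))\le\frac12 d(x_j,y_j)$ whenever $\mathbf x$ and $\mathbf y$ differ at most in the $j$-th coordinate). -/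

import Mathlib

open Filter Topology

namespace HigherMeans

section Means

variable {X : Type*}

/-- An `n`-ary operation is an `n`-mean if it satisfies the generalized idempotency law. -/
def IsMean {n : ℕ} (μ : (Fin n → X) → X) : Prop :=
  ∀ x : X, μ (fun _ => x) = x

/-- Invariance of an `n`-ary operation under all permutations of its arguments. -/
def IsSymmetric {n : ℕ} (μ : (Fin n → X) → X) : Prop :=
  ∀ (π : Equiv.Perm (Fin n)) (x : Fin n → X), μ (fun i => x (π i)) = μ x

/-- The barycentric operator of a `k`-ary operation `μ`: the `j`-th entry of `barycentric μ x` is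
`μ` applied to the `k`-tuple obtained from the `(k+1)`-tuple `x` by deleting the `j`-th entry. -/
def barycentric {k : ℕ} (μ : (Fin k → X) → X) (x : Fin (k + 1) → X) : Fin (k + 1) → X :=
  fun j => μ (fun i => x (j.succAbove i))

/-- A topological `n`-mean: a continuous `n`-mean (used on Hausdorff, indeed metric, spaces). -/
def IsTopologicalMean [TopologicalSpace X] {n : ℕ} (μ : (Fin n → X) → X) : Prop :=
  IsMean μ ∧ Continuous μ

/-- The `(k+1)`-mean `ν` is a `β`-extension of the topological `k`-mean `μ`: the iterates of the
barycentric operator of `μ` at `x` converge to the constant tuple with value `ν x`. -/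
def IsBetaExtension [TopologicalSpace X] {k : ℕ}
    (μ : (Fin k → X) → X) (ν : (Fin (k + 1) → X) → X) : Prop :=
  IsTopologicalMean μ ∧ IsMean ν ∧
    ∀ x : Fin (k + 1) → X,
      Tendsto (fun N : ℕ => (barycentric μ)^[N] x) atTop (𝓝 (fun _ => ν x))

/-- A family of operations `ν n` (only the arities `n ≥ 2` matter) obtained from the `2`-mean `μ`
by inductive `β`-extension. -/
def IsInductiveBetaExtension [TopologicalSpace X]
    (μ : (Fin 2 → X) → X) (ν : (n : ℕ) → (Fin n → X) → X) : Prop :=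
  ν 2 = μ ∧ ∀ n, 2 ≤ n → IsBetaExtension (ν n) (ν (n + 1))

/-- Nonexpansive: Lipschitz with constant `1` for the sup metric on `X^n`. -/
def IsNonexpansive [MetricSpace X] {n : ℕ} (μ : (Fin n → X) → X) : Prop :=
  ∀ x y : Fin n → X, dist (μ x) (μ y) ≤ dist x y

/-- Coordinatewise `ρ`-contractive: if `x` and `y` differ only in the `j`-th coordinate, then
`d(μ x, μ y) ≤ ρ d(x_j, y_j)`. -/
def IsCoordContractive [MetricSpace X] (ρ : ℝ) {n : ℕ} (μ : (Fin n → X) → X) : Prop :=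
  ∀ (x y : Fin n → X) (j : Fin n), (∀ i, i ≠ j → x i = y i) →
    dist (μ x) (μ y) ≤ ρ * dist (x j) (y j)

/-- A convex `2`-mean: a symmetric `2`-mean on a complete metric space satisfying the basic
convexity condition `d(x # z, y # z) ≤ (1/2) d(x, y)`. -/
def IsConvexMean [MetricSpace X] (μ : (Fin 2 → X) → X) : Prop :=
  CompleteSpace X ∧ IsMean μ ∧ IsSymmetric μ ∧
    ∀ x y z : X, dist (μ ![x, z]) (μ ![y, z]) ≤ (1 / 2) * dist x y

/-- `p` is a metric midpoint of `a` and `b`. -/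
def IsMetricMidpoint [MetricSpace X] (a b p : X) : Prop :=
  dist p a = (1 / 2) * dist a b ∧ dist p b = (1 / 2) * dist a b

end Means

noncomputable section PositiveDefinite

open scoped ComplexOrder MatrixOrder

/-- The set of positive definite `m × m` matrices over `𝕜`. It is a `def` so that it carries no
metric or topology other than the one put on it explicitly. -/
def PosDefMatrix (𝕜 : Type*) [RCLike 𝕜] (m : ℕ) : Type _ :=
  {A : Matrix (Fin m) (Fin m) 𝕜 // A.PosDef}

variable {𝕜 : Type*} [RCLike 𝕜] {m : ℕ}

/-- The underlying matrix. -/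
def PosDefMatrix.toMatrix (A : PosDefMatrix 𝕜 m) : Matrix (Fin m) (Fin m) 𝕜 := A.1

theorem PosDefMatrix.posDef (A : PosDefMatrix 𝕜 m) : A.toMatrix.PosDef := A.2

/-- The Riemannian trace metric: `⟨H, K⟩_P = tr (P⁻¹ H P⁻¹ K)` for Hermitian `H`, `K`, at the
positive definite matrix `P`. (The trace is then real.) -/
def traceInner (P H K : Matrix (Fin m) (Fin m) 𝕜) : ℝ :=
  RCLike.re (P⁻¹ * H * P⁻¹ * K).trace

/-- `γ` is a `C¹` curve of positive definite matrices from `A` to `B`, parametrized by `[0, 1]`,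
with velocity `γ'`. -/
structure IsC1Curve (A B : PosDefMatrix 𝕜 m) (γ γ' : ℝ → Matrix (Fin m) (Fin m) 𝕜) : Prop where
  source : γ 0 = A.toMatrix
  target : γ 1 = B.toMatrix
  posDef : ∀ t ∈ Set.Icc (0 : ℝ) 1, (γ t).PosDef
  hasDeriv : ∀ t ∈ Set.Icc (0 : ℝ) 1, HasDerivWithinAt γ (γ' t) (Set.Icc 0 1) t
  continuousDeriv : ContinuousOn γ' (Set.Icc 0 1)

/-- The length, for the Riemannian trace metric, of the curve `γ` with velocity `γ'`. -/
def curveLength (γ γ' : ℝ → Matrix (Fin m) (Fin m) 𝕜) : ℝ :=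
  ∫ t in (0 : ℝ)..1, Real.sqrt (traceInner (γ t) (γ' t) (γ' t))

/-- The length distance of the Riemannian trace metric: the infimum of the lengths of the `C¹`
curves joining two positive definite matrices. -/
def traceDist (A B : PosDefMatrix 𝕜 m) : ℝ :=
  sInf {L : ℝ | ∃ γ γ' : ℝ → Matrix (Fin m) (Fin m) 𝕜, IsC1Curve A B γ γ' ∧ L = curveLength γ γ'}

theorem posDef_sqrt {A : Matrix (Fin m) (Fin m) 𝕜} (hA : A.PosDef) : (CFC.sqrt A).PosDef := by
  have h0 : (CFC.sqrt A).PosSemidef := Matrix.nonneg_iff_posSemidef.1 (CFC.sqrt_nonneg A)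
  rw [h0.posDef_iff_isUnit]
  have h1 : CFC.sqrt A * CFC.sqrt A = A := CFC.sqrt_mul_sqrt_self A hA.posSemidef.nonneg
  rw [Matrix.isUnit_iff_isUnit_det]
  have h2 := (Matrix.isUnit_iff_isUnit_det A).1 hA.isUnit
  rw [← h1, Matrix.det_mul] at h2
  exact isUnit_of_mul_isUnit_left h2

theorem posDef_conj {S A : Matrix (Fin m) (Fin m) 𝕜} (hS : S.PosDef) (hA : A.PosDef) :
    (S * A * S).PosDef := by
  have h := hA.conjTranspose_mul_mul_same (B := S)
    (Matrix.mulVec_injective_iff_isUnit.2 hS.isUnit)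
  rwa [hS.isHermitian.eq] at h

/-- The geometric mean `A # B = A^{1/2} (A^{-1/2} B A^{-1/2})^{1/2} A^{1/2}`. -/
def geomMean (A B : PosDefMatrix 𝕜 m) : PosDefMatrix 𝕜 m :=
  ⟨CFC.sqrt A.toMatrix *
      CFC.sqrt ((CFC.sqrt A.toMatrix)⁻¹ * B.toMatrix * (CFC.sqrt A.toMatrix)⁻¹) *
      CFC.sqrt A.toMatrix,
    posDef_conj (posDef_sqrt A.posDef)
      (posDef_sqrt (posDef_conj (posDef_sqrt A.posDef).inv B.posDef))⟩

/-- The geometric mean as a `2`-ary operation on positive definite matrices. -/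
def geomMean2 (x : Fin 2 → PosDefMatrix 𝕜 m) : PosDefMatrix 𝕜 m :=
  geomMean (x 0) (x 1)

end PositiveDefinite

end HigherMeans

/-!
The proof rests on one inequality, the finite form of the exponential metric increasing property:
for positive definite `P` and `Q`,

  `‖log Q - log P‖² ≤ tr (P⁻¹ (Q - P) Q⁻¹ (Q - P))`

in the Frobenius norm (`norm_sq_matrixLog_sub_le`). Written in eigenbases `uᵢ` of `P` and `vⱼ` of
`Q`, with eigenvalues `dᵢ` and `eⱼ`, both sides are sums with the weights `|⟨uᵢ, vⱼ⟩|²`, and the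
inequality reduces to `(log e - log d)² ≤ (e - d)² / (d e)` for positive reals. Applied to the
points `γ t` and `γ (t + h)` of a `C¹` curve, it shows that the upper right derivative of `‖log (γ
t) - log A‖` is at most the speed of `γ`. So `‖log B - log A‖ ≤ d(A, B)`, without any
differentiation of the logarithm, and equality holds when `A` and `B` commute, because of the
explicit curve between them.

Congruences `A ↦ S A S` are isometries, and there is one which takes a given point to the
identity. This yields the triangle inequality and the formula `d(A, B) = ‖log (A^{-1/2} B
A^{-1/2})‖`. A congruence taking `M = A # B` to the identity makes `A` and `B` inverse to each
other, by the Riccati equation `M A⁻¹ M = B`; with `A = exp X`, `B = exp (-X)`, `C = exp Y`, the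
parallelogram law for `X` and `Y` becomes the semiparallelogram law

  `d(A, B)² / 2 + 2 d(M, C)² ≤ d(A, C)² + d(B, C)²`

(`isSemiparallelogramMidpoint_geomMean`). It implies that midpoints are unique, and, used twice,
that `d(A # C, B # C) ≤ d(A, B) / 2`. Completeness follows from that of the Hermitian matrices
through the logarithm.

The extension to more variables is a statement about complete metric spaces. For a symmetric,
nonexpansive, coordinatewise `ρ`-contractive mean with `ρ < 1`, the tuples obtained from `x` by
deleting its `i`-th and its `j`-th entry differ, up to a permutation, in one coordinate only.
Hence each application of the barycentric operator shrinks all mutual distances of the entries by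
the factor `ρ`, while no entry moves farther than these distances: the iterates converge to a
constant tuple. The limit inherits all the hypotheses
(`IsContractiveMean.exists_isBetaExtension`), so that the construction can be repeated.
-/

namespace HigherMeans

open scoped ComplexOrder MatrixOrder

/-! ### Midpoints in spaces satisfying the semiparallelogram law -/

section Semiparallelogram

variable {X : Type*} [MetricSpace X]

/-- `mid` selects midpoints for which the semiparallelogram law (the `CAT(0)` inequality of
Bruhat and Tits) holds. -/
structure IsSemiparallelogramMidpoint (mid : X → X → X) : Prop where
  isMetricMidpoint : ∀ a b, IsMetricMidpoint a b (mid a b)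
  semiparallelogram : ∀ a b c,
    dist a b ^ 2 / 2 + 2 * dist (mid a b) c ^ 2 ≤ dist a c ^ 2 + dist b c ^ 2

namespace IsSemiparallelogramMidpoint

variable {mid : X → X → X} (h : IsSemiparallelogramMidpoint mid)

include h

theorem isMetricMidpoint_iff (a b p : X) : IsMetricMidpoint a b p ↔ p = mid a b := by
  refine ⟨fun hp => ?_, fun hp => hp ▸ h.isMetricMidpoint a b⟩
  have h1 := h.semiparallelogram a b p
  rw [dist_comm a p, dist_comm b p, hp.1, hp.2] at h1
  have h2 : dist (mid a b) p ^ 2 ≤ 0 := by nlinarith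
  have h3 : dist (mid a b) p = 0 := pow_eq_zero_iff two_ne_zero |>.1 (le_antisymm h2 (sq_nonneg _))
  exact (dist_eq_zero.1 h3).symm

theorem mid_self (a : X) : mid a a = a :=
  ((h.isMetricMidpoint_iff a a a).1 (by simp [IsMetricMidpoint])).symm

theorem mid_comm (a b : X) : mid a b = mid b a := by
  refine (h.isMetricMidpoint_iff b a _).1 ?_
  have h1 := h.isMetricMidpoint a b
  exact ⟨by rw [h1.2, dist_comm], by rw [h1.1, dist_comm]⟩

/-- Busemann convexity: the law is applied to the midpoint of `b, c` seen from `mid a c`, and then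
to the midpoint of `a, c` seen from `b`. -/
theorem dist_mid_le (a b c : X) : dist (mid a c) (mid b c) ≤ (1 / 2) * dist a b := by
  have h1 := h.semiparallelogram b c (mid a c)
  have h2 := h.semiparallelogram a c b
  have h3 := (h.isMetricMidpoint a c).2
  rw [dist_comm (mid b c), dist_comm b (mid a c), dist_comm c (mid a c), h3] at h1
  rw [dist_comm c b] at h2
  refine abs_le_of_sq_le_sq' ?_ (by positivity) |>.2
  nlinarith

end IsSemiparallelogramMidpoint

end Semiparallelogram

/-! ### Extension of coordinatewise contractive means to one more variable -/

section Extension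

variable {X : Type*} [MetricSpace X] {k : ℕ}

theorem IsNonexpansive.continuous {μ : (Fin k → X) → X} (h : IsNonexpansive μ) : Continuous μ :=
  (LipschitzWith.of_dist_le_mul (K := 1) (by simpa [IsNonexpansive] using h)).continuous

theorem IsNonexpansive.barycentric {μ : (Fin k → X) → X} (h : IsNonexpansive μ)
    (x y : Fin (k + 1) → X) :
    dist (barycentric μ x) (barycentric μ y) ≤ dist x y :=
  (dist_pi_le_iff dist_nonneg).2 fun j =>
    (h _ _).trans ((dist_pi_le_iff dist_nonneg).2 fun i => dist_le_pi_dist x y (j.succAbove i))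

theorem IsNonexpansive.dist_iterate_barycentric_le {μ : (Fin k → X) → X} (h : IsNonexpansive μ)
    (x y : Fin (k + 1) → X) (N : ℕ) :
    dist ((HigherMeans.barycentric μ)^[N] x) ((HigherMeans.barycentric μ)^[N] y) ≤ dist x y := by
  induction N with
  | zero => simp
  | succ N ih =>
    rw [Function.iterate_succ_apply', Function.iterate_succ_apply']
    exact (h.barycentric _ _).trans ih

theorem barycentric_const {X : Type*} {μ : (Fin k → X) → X} (h : IsMean μ) (a : X) :
    barycentric μ (fun _ => a) = fun _ => a :=
  funext fun _ => h a

/-- The tuples obtained by deleting the `i`-th and the `j`-th entry agree, up to a permutation,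
outside one coordinate, where they carry `x j` and `x i`. -/
theorem exists_perm_succAbove {i j : Fin (k + 1)} (hij : i ≠ j) :
    ∃ (π : Equiv.Perm (Fin k)) (l : Fin k), i.succAbove l = j ∧ j.succAbove (π l) = i ∧
      ∀ a, a ≠ l → i.succAbove a = j.succAbove (π a) := by
  obtain ⟨l, hl⟩ := Fin.exists_succAbove_eq hij.symm
  have hne : ∀ a, Equiv.swap i j (i.succAbove a) ≠ j := by
    intro a ha
    rw [Equiv.swap_apply_eq_iff, Equiv.swap_apply_right] at ha
    exact Fin.succAbove_ne i a ha
  choose f hf using fun a => Fin.exists_succAbove_eq (hne a)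
  have hinj : Function.Injective f := fun a b hab => by
    have := hf b
    rw [← hab, hf a] at this
    exact Fin.succAbove_right_injective ((Equiv.swap i j).injective this)
  refine ⟨Equiv.ofBijective f (Finite.injective_iff_bijective.1 hinj), l, hl, ?_, ?_⟩
  · simp [hf, hl]
  · intro a ha
    have h1 : i.succAbove a ≠ j := fun h => ha (Fin.succAbove_right_injective (h.trans hl.symm))
    simp [hf, Equiv.swap_apply_of_ne_of_ne (Fin.succAbove_ne i a) h1]

theorem dist_barycentric_apply_le {μ : (Fin k → X) → X} {ρ : ℝ} (hs : IsSymmetric μ)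
    (hc : IsCoordContractive ρ μ) (x : Fin (k + 1) → X) (i j : Fin (k + 1)) :
    dist (barycentric μ x i) (barycentric μ x j) ≤ ρ * dist (x i) (x j) := by
  rcases eq_or_ne i j with rfl | hij
  · simp
  obtain ⟨π, l, h1, h2, h3⟩ := exists_perm_succAbove hij
  have h4 : barycentric μ x j = μ (fun a => x (j.succAbove (π a))) :=
    (hs π fun a => x (j.succAbove a)).symm
  rw [h4, dist_comm (x i)]
  have h5 := hc (fun a => x (i.succAbove a)) (fun a => x (j.succAbove (π a))) l
    (fun a ha => by simp only [h3 a ha])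
  rw [h1, h2] at h5
  exact h5

theorem dist_iterate_barycentric_apply_le {μ : (Fin k → X) → X} {ρ : ℝ} (hρ : 0 ≤ ρ)
    (hs : IsSymmetric μ) (hc : IsCoordContractive ρ μ) (x : Fin (k + 1) → X)
    (i j : Fin (k + 1)) (N : ℕ) :
    dist ((barycentric μ)^[N] x i) ((barycentric μ)^[N] x j) ≤ ρ ^ N * dist (x i) (x j) := by
  induction N with
  | zero => simp
  | succ N ih =>
    rw [Function.iterate_succ_apply', pow_succ', mul_assoc]
    exact (dist_barycentric_apply_le hs hc _ i j).trans (mul_le_mul_of_nonneg_left ih hρ)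

/-- The spread of a tuple, as the sum of all mutual distances of its entries. -/
def spread (x : Fin k → X) : ℝ := ∑ i, ∑ j, dist (x i) (x j)

theorem dist_le_spread (x : Fin k → X) (i j : Fin k) : dist (x i) (x j) ≤ spread x :=
  (Finset.single_le_sum (f := fun j => dist (x i) (x j)) (fun _ _ => dist_nonneg)
    (Finset.mem_univ j)).trans
    (Finset.single_le_sum (f := fun i => ∑ j, dist (x i) (x j))
      (fun _ _ => Finset.sum_nonneg fun _ _ => dist_nonneg) (Finset.mem_univ i))

theorem spread_nonneg (x : Fin k → X) : 0 ≤ spread x :=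
  Finset.sum_nonneg fun _ _ => Finset.sum_nonneg fun _ _ => dist_nonneg

/-- Comparing the `j`-th entry with the `j`-th entry of the constant tuple `x j`, a nonexpansive
mean moves no entry of a tuple farther than the largest mutual distance of the entries. -/
theorem dist_barycentric_le {μ : (Fin k → X) → X} (hm : IsMean μ) (hn : IsNonexpansive μ)
    (x : Fin (k + 1) → X) {D : ℝ} (hD : 0 ≤ D) (hx : ∀ i j, dist (x i) (x j) ≤ D) :
    dist x (barycentric μ x) ≤ D := by
  refine (dist_pi_le_iff hD).2 fun j => ?_
  calc dist (x j) (barycentric μ x j) = dist (μ fun _ => x j) (μ fun i => x (j.succAbove i)) := by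
        rw [hm, barycentric]
    _ ≤ _ := hn _ _
    _ ≤ D := (dist_pi_le_iff hD).2 fun i => hx _ _

/-- The entries of the iterates approach each other geometrically, and one step of the iteration
is no longer than their mutual distance; so the iterates form a Cauchy sequence whose limit is
constant. -/
theorem exists_tendsto_iterate_barycentric [CompleteSpace X] {μ : (Fin k → X) → X} {ρ : ℝ}
    (hρ : 0 ≤ ρ) (hρ1 : ρ < 1) (hm : IsMean μ) (hs : IsSymmetric μ) (hn : IsNonexpansive μ)
    (hc : IsCoordContractive ρ μ) (x : Fin (k + 1) → X) :
    ∃ a : X, Tendsto (fun N : ℕ => (barycentric μ)^[N] x) atTop (𝓝 fun _ => a) := by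
  have hb : ∀ N i j, dist ((barycentric μ)^[N] x i) ((barycentric μ)^[N] x j) ≤ spread x * ρ ^ N :=
    fun N i j => (dist_iterate_barycentric_apply_le hρ hs hc x i j N).trans <| by
      rw [mul_comm]
      exact mul_le_mul_of_nonneg_right (dist_le_spread x i j) (by positivity)
  have hcau : CauchySeq fun N : ℕ => (barycentric μ)^[N] x := by
    refine cauchySeq_of_le_geometric ρ (spread x) hρ1 fun N => ?_
    rw [Function.iterate_succ_apply']
    exact dist_barycentric_le hm hn _ (mul_nonneg (spread_nonneg x) (by positivity)) (hb N)
  obtain ⟨y, hy⟩ := cauchySeq_tendsto_of_complete hcau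
  refine ⟨y 0, ?_⟩
  have hconst : ∀ i, y i = y 0 := fun i => by
    have h1 : Tendsto (fun N => dist ((barycentric μ)^[N] x i) ((barycentric μ)^[N] x 0)) atTop
        (𝓝 (dist (y i) (y 0))) :=
      (tendsto_pi_nhds.1 hy i).dist (tendsto_pi_nhds.1 hy 0)
    have h2 : Tendsto (fun N => spread x * ρ ^ N) atTop (𝓝 0) := by
      simpa using (tendsto_pow_atTop_nhds_zero_of_lt_one hρ hρ1).const_mul (spread x)
    exact dist_le_zero.1 (le_of_tendsto_of_tendsto' h1 h2 fun N => hb N i 0)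
  rwa [funext hconst] at hy

/-- The properties of a mean which are passed on to its `β`-extension. -/
structure IsContractiveMean (ρ : ℝ) (μ : (Fin k → X) → X) : Prop where
  isMean : IsMean μ
  isSymmetric : IsSymmetric μ
  isNonexpansive : IsNonexpansive μ
  isCoordContractive : IsCoordContractive ρ μ

theorem IsContractiveMean.isTopologicalMean {ρ : ℝ} {μ : (Fin k → X) → X}
    (h : IsContractiveMean ρ μ) : IsTopologicalMean μ :=
  ⟨h.isMean, h.isNonexpansive.continuous⟩

theorem iterate_barycentric_comp_perm {X : Type*} {μ : (Fin k → X) → X} (hs : IsSymmetric μ)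
    (π : Equiv.Perm (Fin (k + 1))) (x : Fin (k + 1) → X) (N : ℕ) :
    (barycentric μ)^[N] (fun i => x (π i)) = fun i => (barycentric μ)^[N] x (π i) := by
  have hstep : ∀ y : Fin (k + 1) → X,
      barycentric μ (fun i => y (π i)) = fun i => barycentric μ y (π i) := by
    intro y
    funext j
    choose f hf using fun a : Fin k => Fin.exists_succAbove_eq (x := π (j.succAbove a)) (y := π j)
      (fun h => Fin.succAbove_ne j a (π.injective h))
    have hinj : Function.Injective f := fun a b hab => by
      have := hf b
      rw [← hab, hf a] at this
      exact Fin.succAbove_right_injective (π.injective this)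
    have := hs (Equiv.ofBijective f (Finite.injective_iff_bijective.1 hinj))
      (fun a => y ((π j).succAbove a))
    simp only [Equiv.ofBijective_apply, hf] at this
    exact this
  induction N with
  | zero => rfl
  | succ N ih => rw [Function.iterate_succ_apply', ih, hstep, Function.iterate_succ_apply']

/-- A contractive mean has a `β`-extension, which inherits all its properties. For the
coordinatewise contraction, the first application of the barycentric operator gains the factor
`ρ` and the following ones lose nothing. -/
theorem IsContractiveMean.exists_isBetaExtension [CompleteSpace X] {μ : (Fin k → X) → X} {ρ : ℝ}
    (hρ : 0 ≤ ρ) (hρ1 : ρ < 1) (h : IsContractiveMean ρ μ) :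
    ∃ ν : (Fin (k + 1) → X) → X, IsBetaExtension μ ν ∧ IsContractiveMean ρ ν := by
  choose ν hν using exists_tendsto_iterate_barycentric hρ hρ1 h.isMean h.isSymmetric
    h.isNonexpansive h.isCoordContractive
  have hν0 : ∀ x, Tendsto (fun N : ℕ => (barycentric μ)^[N] x 0) atTop (𝓝 (ν x)) :=
    fun x => tendsto_pi_nhds.1 (hν x) 0
  have hmean : IsMean ν := fun a => by
    refine tendsto_nhds_unique (hν0 _) ?_
    have hfix : ∀ N : ℕ, (barycentric μ)^[N] (fun _ => a) = fun _ => a := fun N =>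
      Function.iterate_fixed (barycentric_const h.isMean a) N
    simp only [hfix, tendsto_const_nhds]
  have hne : ∀ x y M, dist (ν x) (ν y) ≤
      dist ((barycentric μ)^[M] x) ((barycentric μ)^[M] y) := by
    intro x y M
    refine le_of_tendsto ((hν0 x).dist (hν0 y)) ?_
    filter_upwards [eventually_ge_atTop M] with N hN
    obtain ⟨L, rfl⟩ := Nat.exists_eq_add_of_le' hN
    rw [Function.iterate_add_apply, Function.iterate_add_apply]
    exact (dist_le_pi_dist _ _ 0).trans (h.isNonexpansive.dist_iterate_barycentric_le _ _ L)
  refine ⟨ν, ⟨h.isTopologicalMean, hmean, hν⟩, hmean, fun π x => ?_, fun x y => hne x y 0,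
    fun x y j hxy => (hne x y 1).trans ?_⟩
  · refine tendsto_nhds_unique (hν0 _) ?_
    simp only [iterate_barycentric_comp_perm h.isSymmetric]
    exact tendsto_pi_nhds.1 (hν x) (π 0)
  · refine (dist_pi_le_iff (mul_nonneg hρ dist_nonneg)).2 fun i => ?_
    rw [Function.iterate_one]
    rcases eq_or_ne i j with rfl | hij
    · have h1 : (fun a => x (i.succAbove a)) = fun a => y (i.succAbove a) :=
        funext fun a => hxy _ (Fin.succAbove_ne i a)
      have h2 : barycentric μ x i = barycentric μ y i := congrArg μ h1
      rw [h2, dist_self]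
      exact mul_nonneg hρ dist_nonneg
    · obtain ⟨l, hl⟩ := Fin.exists_succAbove_eq hij.symm
      have h1 := h.isCoordContractive (fun a => x (i.succAbove a)) (fun a => y (i.succAbove a)) l
        (fun a ha => hxy _ fun h => ha (Fin.succAbove_right_injective (h.trans hl.symm)))
      rw [hl] at h1
      exact h1

theorem IsBetaExtension.unique {μ : (Fin k → X) → X} {ν ν' : (Fin (k + 1) → X) → X}
    (h : IsBetaExtension μ ν) (h' : IsBetaExtension μ ν') : ν' = ν :=
  funext fun x => congrFun (tendsto_nhds_unique (h'.2.2 x) (h.2.2 x)) 0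

theorem IsInductiveBetaExtension.unique {μ : (Fin 2 → X) → X} {ν ν' : (n : ℕ) → (Fin n → X) → X}
    (h : IsInductiveBetaExtension μ ν) (h' : IsInductiveBetaExtension μ ν') (n : ℕ) (hn : 2 ≤ n) :
    ν' n = ν n := by
  induction n, hn using Nat.le_induction with
  | base => rw [h.1, h'.1]
  | succ n hn ih => exact (h.2 n hn).unique (ih ▸ h'.2 n hn)

/-- Every contractive `2`-mean on a complete metric space extends to all arities. -/
theorem IsContractiveMean.exists_isInductiveBetaExtension [CompleteSpace X] [Nonempty X]
    {ρ : ℝ} (hρ : 0 ≤ ρ) (hρ1 : ρ < 1) {μ : (Fin 2 → X) → X} (h : IsContractiveMean ρ μ) :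
    ∃ ν : (n : ℕ) → (Fin n → X) → X, IsInductiveBetaExtension μ ν ∧
      ∀ n, 2 ≤ n → IsContractiveMean ρ (ν n) := by
  let ext (n : ℕ) (p : {p : (Fin n → X) → X // IsContractiveMean ρ p}) :
      {p : (Fin (n + 1) → X) → X // IsContractiveMean ρ p} :=
    ⟨(p.2.exists_isBetaExtension hρ hρ1).choose,
      (p.2.exists_isBetaExtension hρ hρ1).choose_spec.2⟩
  let fam (n : ℕ) : {p : (Fin (n + 2) → X) → X // IsContractiveMean ρ p} :=
    Nat.rec (motive := fun n => {p : (Fin (n + 2) → X) → X // IsContractiveMean ρ p}) ⟨μ, h⟩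
      (fun n p => ext (n + 2) p) n
  -- the values at the arities `0` and `1` are irrelevant
  let ν : (n : ℕ) → (Fin n → X) → X
    | 0 => fun _ => Classical.arbitrary X
    | 1 => fun x => x 0
    | n + 2 => (fam n).1
  refine ⟨ν, ⟨rfl, fun n hn => ?_⟩, fun n hn => ?_⟩
  · obtain ⟨m, rfl⟩ := Nat.exists_eq_add_of_le' hn
    exact ((fam m).2.exists_isBetaExtension hρ hρ1).choose_spec.1
  · obtain ⟨m, rfl⟩ := Nat.exists_eq_add_of_le' hn
    exact (fam m).2

theorem isContractiveMean_of_isConvexMean {μ : (Fin 2 → X) → X} (h : IsConvexMean μ) :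
    IsContractiveMean (1 / 2) μ := by
  obtain ⟨-, hm, hs, hc⟩ := h
  have heta : ∀ x : Fin 2 → X, x = ![x 0, x 1] := fun x => by
    ext i; fin_cases i <;> rfl
  have hswap : ∀ a b, μ ![a, b] = μ ![b, a] := fun a b => by
    rw [← hs (Equiv.swap 0 1) ![a, b]]
    congr 1
    ext i; fin_cases i <;> rfl
  have hc' : ∀ x y z : X, dist (μ ![z, x]) (μ ![z, y]) ≤ (1 / 2) * dist x y := fun x y z => by
    rw [hswap z x, hswap z y]
    exact hc x y z
  refine ⟨hm, hs, fun x y => ?_, fun x y j hxy => ?_⟩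
  · have h0 := dist_le_pi_dist x y 0
    have h1 := dist_le_pi_dist x y 1
    have h2 := hc (x 0) (y 0) (x 1)
    have h3 := hc' (x 1) (y 1) (y 0)
    rw [heta x, heta y] at *
    have h4 := dist_triangle (μ ![x 0, x 1]) (μ ![y 0, x 1]) (μ ![y 0, y 1])
    simp only [Matrix.cons_val_zero, Matrix.cons_val_one] at *
    linarith
  · rw [heta x, heta y]
    fin_cases j
    · have := hxy 1 (by decide)
      rw [this]
      exact hc _ _ _
    · have := hxy 0 (by decide)
      rw [this]
      exact hc' _ _ _

end Extension

/-! ### Spectral decompositions and the matrix logarithm -/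

section Spectral

variable {𝕜 : Type*} [RCLike 𝕜] {m : ℕ}

/-- The Hermitian matrix `U diag(a) U*` with real eigenvalues `a` and eigenvectors the columns of
the unitary matrix `U`. -/
noncomputable def spectralForm (U : Matrix.unitaryGroup (Fin m) 𝕜) (a : Fin m → ℝ) :
    Matrix (Fin m) (Fin m) 𝕜 :=
  U.1 * Matrix.diagonal (fun i => (a i : 𝕜)) * star U.1

theorem spectralForm_mul (U : Matrix.unitaryGroup (Fin m) 𝕜) (a b : Fin m → ℝ) :
    spectralForm U a * spectralForm U b = spectralForm U (fun i => a i * b i) := by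
  have h : star U.1 * U.1 = 1 := Unitary.coe_star_mul_self U
  calc _ = U.1 * Matrix.diagonal (fun i => (a i : 𝕜)) * (star U.1 * U.1) *
        Matrix.diagonal (fun i => (b i : 𝕜)) * star U.1 := by simp only [spectralForm, mul_assoc]
    _ = _ := by
      rw [h, mul_one, mul_assoc U.1, Matrix.diagonal_mul_diagonal]
      simp [spectralForm]

theorem spectralForm_one (U : Matrix.unitaryGroup (Fin m) 𝕜) :
    spectralForm U (fun _ => 1) = 1 := by
  simp [spectralForm]

theorem spectralForm_neg (U : Matrix.unitaryGroup (Fin m) 𝕜) (a : Fin m → ℝ) :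
    spectralForm U (fun i => -a i) = -spectralForm U a := by
  have h : Matrix.diagonal (fun i => ((-a i : ℝ) : 𝕜)) =
      -Matrix.diagonal (fun i => (a i : 𝕜)) := by
    rw [Matrix.diagonal_neg]; congr 1; ext i; simp
  rw [spectralForm, h, mul_neg, neg_mul, spectralForm]

theorem spectralForm_sub (U : Matrix.unitaryGroup (Fin m) 𝕜) (a b : Fin m → ℝ) :
    spectralForm U (fun i => a i - b i) = spectralForm U a - spectralForm U b := by
  have h : Matrix.diagonal (fun i => ((a i - b i : ℝ) : 𝕜)) =
      Matrix.diagonal (fun i => (a i : 𝕜)) - Matrix.diagonal (fun i => (b i : 𝕜)) := by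
    rw [Matrix.diagonal_sub]; congr 1; ext i; simp
  rw [spectralForm, h, mul_sub, sub_mul, spectralForm, spectralForm]

theorem spectralForm_inv (U : Matrix.unitaryGroup (Fin m) 𝕜) {a : Fin m → ℝ}
    (ha : ∀ i, a i ≠ 0) : (spectralForm U a)⁻¹ = spectralForm U (fun i => (a i)⁻¹) := by
  refine Matrix.inv_eq_right_inv ?_
  rw [spectralForm_mul, ← spectralForm_one U]
  congr 1
  ext i
  exact mul_inv_cancel₀ (ha i)

theorem isHermitian_spectralForm (U : Matrix.unitaryGroup (Fin m) 𝕜) (a : Fin m → ℝ) :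
    (spectralForm U a).IsHermitian := by
  have h : Matrix.diagonal (fun i => (a i : 𝕜)) |>.IsHermitian :=
    Matrix.isHermitian_diagonal_of_self_adjoint _ (funext fun i => by simp)
  exact Matrix.isHermitian_mul_mul_conjTranspose U.1 h

theorem posDef_spectralForm (U : Matrix.unitaryGroup (Fin m) 𝕜) {a : Fin m → ℝ}
    (ha : ∀ i, 0 < a i) : (spectralForm U a).PosDef :=
  (Matrix.IsUnit.posDef_star_right_conjugate_iff (Unitary.isUnit_coe (U := U))).2
    (Matrix.PosDef.diagonal fun i => by exact_mod_cast ha i)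

theorem eq_spectralForm {A : Matrix (Fin m) (Fin m) 𝕜} (hA : A.IsHermitian) :
    A = spectralForm hA.eigenvectorUnitary hA.eigenvalues := by
  conv_lhs => rw [hA.spectral_theorem, Unitary.conjStarAlgAut_apply]
  rfl

theorem exp_spectralForm (U : Matrix.unitaryGroup (Fin m) 𝕜) (a : Fin m → ℝ) :
    NormedSpace.exp (spectralForm U a) = spectralForm U (fun i => Real.exp (a i)) := by
  have h : star U.1 = (U.1)⁻¹ := (Matrix.inv_eq_left_inv (Unitary.coe_star_mul_self U)).symm
  rw [spectralForm, h, Matrix.exp_conj _ _ (Unitary.isUnit_coe (U := U)), Matrix.exp_diagonal,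
    spectralForm, h]
  congr 3
  ext i
  rw [Pi.coe_exp, Real.exp_eq_exp_ℝ]
  exact (NormedSpace.algebraMap_exp_comm (a i)).symm

/-- A matrix as an element of the Euclidean space of its entries, whose norm is the Frobenius
norm. -/
noncomputable def toFrobenius (K : Matrix (Fin m) (Fin m) 𝕜) :
    EuclideanSpace 𝕜 (Fin m × Fin m) :=
  WithLp.toLp 2 fun p => K p.1 p.2

theorem toFrobenius_sub (K L : Matrix (Fin m) (Fin m) 𝕜) :
    toFrobenius (K - L) = toFrobenius K - toFrobenius L := rfl

theorem toFrobenius_neg (K : Matrix (Fin m) (Fin m) 𝕜) :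
    toFrobenius (-K) = -toFrobenius K := rfl

theorem toFrobenius_injective {𝕜 : Type*} :
    Function.Injective (toFrobenius : Matrix (Fin m) (Fin m) 𝕜 → _) := fun K L h => by
  ext i j
  exact congrArg (fun v : EuclideanSpace 𝕜 (Fin m × Fin m) => v (i, j)) h

theorem norm_sq_toFrobenius (K : Matrix (Fin m) (Fin m) 𝕜) :
    ‖toFrobenius K‖ ^ 2 = ∑ i, ∑ j, ‖K i j‖ ^ 2 := by
  rw [EuclideanSpace.norm_sq_eq, Fintype.sum_prod_type]
  rfl

/-- A trace form in which each of the two Hermitian matrices is diagonalized in its own basis. -/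
theorem re_trace_spectralForm (U V : Matrix.unitaryGroup (Fin m) 𝕜) (a b : Fin m → ℝ)
    (K : Matrix (Fin m) (Fin m) 𝕜) :
    RCLike.re (spectralForm U a * K * spectralForm V b * star K).trace =
      ∑ i, ∑ j, a i * b j * ‖(star U.1 * K * V.1) i j‖ ^ 2 := by
  have h : (spectralForm U a * K * spectralForm V b * star K).trace =
      (Matrix.diagonal (fun i => (a i : 𝕜)) * (star U.1 * K * V.1) *
        Matrix.diagonal (fun i => (b i : 𝕜)) * star (star U.1 * K * V.1)).trace := by
    simp only [spectralForm, star_mul, star_star, mul_assoc]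
    rw [Matrix.trace_mul_comm]
    simp only [mul_assoc]
  rw [h, Matrix.trace, map_sum]
  refine Finset.sum_congr rfl fun i _ => ?_
  rw [Matrix.diag_apply, Matrix.mul_apply, map_sum]
  refine Finset.sum_congr rfl fun j _ => ?_
  rw [Matrix.mul_diagonal, Matrix.diagonal_mul, Matrix.star_apply]
  generalize (star U.1 * K * V.1) i j = z
  have h2 : (a i : 𝕜) * z * (b j : 𝕜) * star z = ((a i * b j * ‖z‖ ^ 2 : ℝ) : 𝕜) := by
    have := RCLike.mul_conj z
    rw [RCLike.star_def]
    push_cast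
    rw [← this]; ring
  rw [h2, RCLike.ofReal_re]

theorem norm_sq_toFrobenius_eq_trace (K : Matrix (Fin m) (Fin m) 𝕜) :
    ‖toFrobenius K‖ ^ 2 = RCLike.re (K * star K).trace := by
  have h := re_trace_spectralForm (1 : Matrix.unitaryGroup (Fin m) 𝕜) 1 (fun _ => 1)
    (fun _ => 1) K
  simp only [spectralForm_one, mul_one, one_mul, OneMemClass.coe_one, star_one] at h
  rw [norm_sq_toFrobenius, ← h]

theorem norm_sq_toFrobenius_eq_sum_unitary (U V : Matrix.unitaryGroup (Fin m) 𝕜)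
    (K : Matrix (Fin m) (Fin m) 𝕜) :
    ‖toFrobenius K‖ ^ 2 = ∑ i, ∑ j, ‖(star U.1 * K * V.1) i j‖ ^ 2 := by
  have h := re_trace_spectralForm U V (fun _ => 1) (fun _ => 1) K
  simp only [spectralForm_one, mul_one, one_mul] at h
  rw [norm_sq_toFrobenius_eq_trace, h]

/-- In the mixed bases of `P` and `Q`, the matrix `f(Q) - f(P)` has the entries
`(f(eⱼ) - f(dᵢ)) ⟨uᵢ, vⱼ⟩`. -/
theorem star_mul_spectralForm_sub_mul (U V : Matrix.unitaryGroup (Fin m) 𝕜) (d e : Fin m → ℝ)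
    (i j : Fin m) :
    (star U.1 * (spectralForm V e - spectralForm U d) * V.1) i j =
      ((e j - d i : ℝ) : 𝕜) * (star U.1 * V.1) i j := by
  have hU : star U.1 * U.1 = 1 := Unitary.coe_star_mul_self U
  have hV : star V.1 * V.1 = 1 := Unitary.coe_star_mul_self V
  have h : star U.1 * (spectralForm V e - spectralForm U d) * V.1 =
      (star U.1 * V.1) * Matrix.diagonal (fun i => (e i : 𝕜)) -
        Matrix.diagonal (fun i => (d i : 𝕜)) * (star U.1 * V.1) := by
    calc _ = star U.1 * V.1 * Matrix.diagonal (fun i => (e i : 𝕜)) * (star V.1 * V.1) -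
          (star U.1 * U.1) * Matrix.diagonal (fun i => (d i : 𝕜)) * (star U.1 * V.1) := by
          simp only [spectralForm, mul_sub, sub_mul, mul_assoc]
      _ = _ := by rw [hU, hV, mul_one, one_mul]
  rw [h, Matrix.sub_apply, Matrix.mul_diagonal, Matrix.diagonal_mul]
  push_cast
  ring

theorem norm_sq_toFrobenius_spectralForm_sub (U V : Matrix.unitaryGroup (Fin m) 𝕜)
    (d e : Fin m → ℝ) :
    ‖toFrobenius (spectralForm V e - spectralForm U d)‖ ^ 2 =
      ∑ i, ∑ j, (e j - d i) ^ 2 * ‖(star U.1 * V.1) i j‖ ^ 2 := by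
  rw [norm_sq_toFrobenius_eq_sum_unitary U V]
  refine Finset.sum_congr rfl fun i _ => Finset.sum_congr rfl fun j _ => ?_
  rw [star_mul_spectralForm_sub_mul, norm_mul, mul_pow, RCLike.norm_ofReal, sq_abs]

/-- The logarithm of a Hermitian matrix, obtained by applying `Real.log` to the eigenvalues
(and the junk value `0` at the other matrices). -/
noncomputable def matrixLog (A : Matrix (Fin m) (Fin m) 𝕜) : Matrix (Fin m) (Fin m) 𝕜 :=
  open scoped Classical in
  if h : A.IsHermitian then
    spectralForm h.eigenvectorUnitary (fun i => Real.log (h.eigenvalues i))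
  else 0

/-- The value of a function at a Hermitian matrix does not depend on the choice of the spectral
decomposition: eigenvectors `uᵢ` and `vⱼ` which are not orthogonal have the same eigenvalue. -/
theorem spectralForm_comp_eq {U V : Matrix.unitaryGroup (Fin m) 𝕜} {d e : Fin m → ℝ} (f : ℝ → ℝ)
    (h : spectralForm U d = spectralForm V e) :
    spectralForm U (fun i => f (d i)) = spectralForm V (fun i => f (e i)) := by
  have h1 := norm_sq_toFrobenius_spectralForm_sub U V d e
  rw [h, sub_self, norm_sq_toFrobenius] at h1
  simp only [Matrix.zero_apply, norm_zero, ne_eq, OfNat.ofNat_ne_zero, not_false_eq_true, zero_pow,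
    Finset.sum_const_zero] at h1
  have h2 : ∀ i j, (e j - d i) ^ 2 * ‖(star U.1 * V.1) i j‖ ^ 2 = 0 := fun i j =>
    (Finset.sum_eq_zero_iff_of_nonneg fun _ _ => by positivity).1
      ((Finset.sum_eq_zero_iff_of_nonneg fun _ _ =>
        Finset.sum_nonneg fun _ _ => by positivity).1 h1.symm i (Finset.mem_univ i))
      j (Finset.mem_univ j)
  have h3 := norm_sq_toFrobenius_spectralForm_sub U V (fun i => f (d i)) (fun i => f (e i))
  rw [Finset.sum_eq_zero fun i _ => Finset.sum_eq_zero fun j _ => ?_] at h3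
  · rw [pow_eq_zero_iff two_ne_zero, norm_eq_zero] at h3
    exact (sub_eq_zero.1 (toFrobenius_injective (h3.trans rfl))).symm
  · rcases mul_eq_zero.1 (h2 i j) with h4 | h4
    · rw [sub_eq_zero.1 (pow_eq_zero_iff two_ne_zero |>.1 h4), sub_self]; simp
    · rw [h4, mul_zero]

theorem matrixLog_spectralForm (U : Matrix.unitaryGroup (Fin m) 𝕜) (a : Fin m → ℝ) :
    matrixLog (spectralForm U a) = spectralForm U (fun i => Real.log (a i)) := by
  have h := isHermitian_spectralForm U a
  rw [matrixLog, dif_pos h]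
  exact spectralForm_comp_eq Real.log (eq_spectralForm h).symm

theorem isHermitian_matrixLog (A : Matrix (Fin m) (Fin m) 𝕜) : (matrixLog A).IsHermitian := by
  rw [matrixLog]
  split_ifs with h
  · exact isHermitian_spectralForm _ _
  · exact Matrix.isHermitian_zero

theorem exists_eq_spectralForm {A : Matrix (Fin m) (Fin m) 𝕜} (hA : A.PosDef) :
    ∃ (U : Matrix.unitaryGroup (Fin m) 𝕜) (a : Fin m → ℝ),
      (∀ i, 0 < a i) ∧ A = spectralForm U a :=
  ⟨_, _, hA.eigenvalues_pos, eq_spectralForm hA.isHermitian⟩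

theorem exp_matrixLog {A : Matrix (Fin m) (Fin m) 𝕜} (hA : A.PosDef) :
    NormedSpace.exp (matrixLog A) = A := by
  obtain ⟨U, a, ha, rfl⟩ := exists_eq_spectralForm hA
  rw [matrixLog_spectralForm, exp_spectralForm]
  simp only [Real.exp_log (ha _)]

theorem matrixLog_one : matrixLog (1 : Matrix (Fin m) (Fin m) 𝕜) = 0 := by
  rw [← spectralForm_one 1, matrixLog_spectralForm]
  simp [spectralForm]

theorem matrixLog_inv {A : Matrix (Fin m) (Fin m) 𝕜} (hA : A.PosDef) :
    matrixLog A⁻¹ = -matrixLog A := by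
  obtain ⟨U, a, ha, rfl⟩ := exists_eq_spectralForm hA
  rw [spectralForm_inv U fun i => (ha i).ne', matrixLog_spectralForm, matrixLog_spectralForm,
    ← spectralForm_neg]
  simp only [Real.log_inv]

theorem posDef_exp {X : Matrix (Fin m) (Fin m) 𝕜} (hX : X.IsHermitian) :
    (NormedSpace.exp X).PosDef := by
  rw [eq_spectralForm hX, exp_spectralForm]
  exact posDef_spectralForm _ fun i => Real.exp_pos _

/-- With `a / b = exp (2 s)` this is the inequality `|s| ≤ |sinh s|`. -/
theorem sq_log_sub_log_le {a b : ℝ} (ha : 0 < a) (hb : 0 < b) :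
    (Real.log b - Real.log a) ^ 2 ≤ a⁻¹ * b⁻¹ * (b - a) ^ 2 := by
  set x := Real.log a with hx
  set y := Real.log b with hy
  have h1 : |(y - x) / 2| ≤ |Real.sinh ((y - x) / 2)| := by
    rw [Real.abs_sinh]; exact Real.self_le_sinh_iff.2 (abs_nonneg _)
  have h2 := sq_le_sq.2 h1
  have h3 : a⁻¹ * b⁻¹ * (b - a) ^ 2 = 4 * Real.sinh ((y - x) / 2) ^ 2 := by
    have ea : a = Real.exp (x / 2) ^ 2 := by
      rw [← Real.exp_nat_mul, hx]; norm_num [mul_div_cancel₀, Real.exp_log ha]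
    have eb : b = Real.exp (y / 2) ^ 2 := by
      rw [← Real.exp_nat_mul, hy]; norm_num [mul_div_cancel₀, Real.exp_log hb]
    rw [Real.sinh_eq, show (y - x) / 2 = y / 2 - x / 2 by ring, neg_sub, Real.exp_sub,
      Real.exp_sub, ea, eb]
    have := Real.exp_pos (x / 2)
    have := Real.exp_pos (y / 2)
    field_simp
    ring
  rw [h3]
  nlinarith

/-- The finite form of the exponential metric increasing property. Both sides are sums over the
same weights `|⟨uᵢ, vⱼ⟩|²`, where `uᵢ` and `vⱼ` are eigenbases of `P` and `Q`. -/
theorem norm_sq_matrixLog_sub_le {P Q : Matrix (Fin m) (Fin m) 𝕜} (hP : P.PosDef) (hQ : Q.PosDef) :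
    ‖toFrobenius (matrixLog Q) - toFrobenius (matrixLog P)‖ ^ 2 ≤
      RCLike.re (P⁻¹ * (Q - P) * Q⁻¹ * (Q - P)).trace := by
  have hH : star (Q - P) = Q - P := hQ.isHermitian.sub hP.isHermitian
  obtain ⟨U, d, hd, rfl⟩ := exists_eq_spectralForm hP
  obtain ⟨V, e, he, rfl⟩ := exists_eq_spectralForm hQ
  have h := re_trace_spectralForm U V (fun i => (d i)⁻¹) (fun i => (e i)⁻¹)
    (spectralForm V e - spectralForm U d)
  rw [hH, ← spectralForm_inv U fun i => (hd i).ne', ← spectralForm_inv V fun i => (he i).ne'] at h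
  rw [h, ← toFrobenius_sub, matrixLog_spectralForm, matrixLog_spectralForm,
    norm_sq_toFrobenius_spectralForm_sub]
  refine Finset.sum_le_sum fun i _ => Finset.sum_le_sum fun j _ => ?_
  rw [star_mul_spectralForm_sub_mul, norm_mul, mul_pow, RCLike.norm_ofReal, sq_abs, ← mul_assoc]
  exact mul_le_mul_of_nonneg_right (sq_log_sub_log_le (hd i) (he j)) (by positivity)

theorem continuous_matrix_exp :
    Continuous (NormedSpace.exp : Matrix (Fin m) (Fin m) 𝕜 → Matrix (Fin m) (Fin m) 𝕜) :=
  open scoped Matrix.Norms.Operator in NormedSpace.exp_continuous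

theorem continuousAt_inv_of_posDef {P : Matrix (Fin m) (Fin m) 𝕜} (hP : P.PosDef) :
    ContinuousAt (fun Q : Matrix (Fin m) (Fin m) 𝕜 => Q⁻¹) P := by
  refine continuousAt_matrix_inv P ?_
  rw [Ring.inverse_eq_inv']
  exact continuousAt_inv₀ hP.det_pos.ne'

theorem continuousOn_matrixLog :
    ContinuousOn (fun P : Matrix (Fin m) (Fin m) 𝕜 => toFrobenius (matrixLog P))
      {P | P.PosDef} := by
  intro P hP
  have hinv := (continuousAt_inv_of_posDef hP).tendsto
  have h1 : Tendsto (fun Q => RCLike.re (P⁻¹ * (Q - P) * Q⁻¹ * (Q - P)).trace) (𝓝 P) (𝓝 0) := by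
    have h2 : Tendsto (fun Q : Matrix (Fin m) (Fin m) 𝕜 => Q - P) (𝓝 P) (𝓝 0) := by
      simpa using (tendsto_id (x := 𝓝 P)).sub_const P
    have h3 := ((h2.const_mul P⁻¹).mul hinv).mul h2
    have h4 : Continuous fun K : Matrix (Fin m) (Fin m) 𝕜 => RCLike.re K.trace :=
      RCLike.continuous_re.comp continuous_id.matrix_trace
    simpa [Function.comp_def] using (h4.tendsto _).comp h3
  have h5 := (h1.mono_left (nhdsWithin_le_nhds (s := {P | P.PosDef}))).sqrt
  rw [Real.sqrt_zero] at h5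
  rw [ContinuousWithinAt, tendsto_iff_norm_sub_tendsto_zero]
  refine tendsto_of_tendsto_of_tendsto_of_le_of_le' tendsto_const_nhds h5
    (Eventually.of_forall fun _ => norm_nonneg _) ?_
  filter_upwards [self_mem_nhdsWithin] with Q hQ
  exact Real.le_sqrt_of_sq_le (norm_sq_matrixLog_sub_le hP hQ)

end Spectral

/-! ### Lengths of curves -/

section Curves

variable {𝕜 : Type*} [RCLike 𝕜] {m : ℕ}

/-- Matrices carry the product topology but no preferred norm; the slope characterization of
derivatives is obtained through an auxiliary norm that induces this topology. -/
theorem hasDerivWithinAt_matrix_iff_tendsto_slope {γ : ℝ → Matrix (Fin m) (Fin m) 𝕜}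
    {γ' : Matrix (Fin m) (Fin m) 𝕜} {s : Set ℝ} {x : ℝ} :
    HasDerivWithinAt γ γ' s x ↔ Tendsto (slope γ x) (𝓝[s \ {x}] x) (𝓝 γ') :=
  open scoped Matrix.Norms.Operator in hasDerivWithinAt_iff_tendsto_slope

theorem hasDerivWithinAt_const_mul_mul_const {γ : ℝ → Matrix (Fin m) (Fin m) 𝕜}
    {γ' : Matrix (Fin m) (Fin m) 𝕜} {s : Set ℝ} {x : ℝ} (h : HasDerivWithinAt γ γ' s x)
    (S T : Matrix (Fin m) (Fin m) 𝕜) :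
    HasDerivWithinAt (fun t => S * γ t * T) (S * γ' * T) s x := by
  rw [hasDerivWithinAt_matrix_iff_tendsto_slope] at h ⊢
  refine ((h.const_mul S).mul_const T).congr fun t => ?_
  simp only [slope_def_module, mul_sub, sub_mul, smul_sub, mul_smul_comm, smul_mul_assoc]

theorem hasDerivWithinAt_diagonal {a : ℝ → Fin m → ℝ} {a' : Fin m → ℝ} {s : Set ℝ} {x : ℝ}
    (h : ∀ i, HasDerivWithinAt (fun t => a t i) (a' i) s x) :
    HasDerivWithinAt (fun t => Matrix.diagonal fun i => (a t i : 𝕜))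
      (Matrix.diagonal fun i => (a' i : 𝕜)) s x := by
  rw [hasDerivWithinAt_matrix_iff_tendsto_slope]
  have h1 : Tendsto (fun t i => ((slope (fun t => a t i) x t : ℝ) : 𝕜)) (𝓝[s \ {x}] x)
      (𝓝 fun i => (a' i : 𝕜)) :=
    tendsto_pi_nhds.2 fun i => (RCLike.continuous_ofReal.tendsto _).comp
      (hasDerivWithinAt_iff_tendsto_slope.1 (h i))
  have h2 : Continuous (Matrix.diagonal : (Fin m → 𝕜) → Matrix (Fin m) (Fin m) 𝕜) :=
    continuous_id.matrix_diagonal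
  refine ((h2.tendsto _).comp h1).congr fun t => ?_
  rw [slope_def_module, Matrix.diagonal_sub, ← Matrix.diagonal_smul, Function.comp_apply]
  congr 1
  ext i
  simp [slope_def_module, RCLike.real_smul_eq_coe_mul]

theorem hasDerivWithinAt_spectralForm (U : Matrix.unitaryGroup (Fin m) 𝕜) {a : ℝ → Fin m → ℝ}
    {a' : Fin m → ℝ} {s : Set ℝ} {x : ℝ}
    (h : ∀ i, HasDerivWithinAt (fun t => a t i) (a' i) s x) :
    HasDerivWithinAt (fun t => spectralForm U (a t)) (spectralForm U a') s x :=
  hasDerivWithinAt_const_mul_mul_const (hasDerivWithinAt_diagonal h) _ _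

theorem continuous_spectralForm (U : Matrix.unitaryGroup (Fin m) 𝕜) :
    Continuous (spectralForm U) := by
  unfold spectralForm
  have h : Continuous fun a : Fin m → ℝ => Matrix.diagonal fun i => (a i : 𝕜) :=
    (continuous_pi fun i => RCLike.continuous_ofReal.comp (continuous_apply i)).matrix_diagonal
  exact (h.const_mul _).mul_const _

theorem IsC1Curve.continuousOn {A B : PosDefMatrix 𝕜 m} {γ γ' : ℝ → Matrix (Fin m) (Fin m) 𝕜}
    (h : IsC1Curve A B γ γ') : ContinuousOn γ (Set.Icc 0 1) :=
  open scoped Matrix.Norms.Operator in fun t ht => (h.hasDeriv t ht).continuousWithinAt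

theorem IsC1Curve.continuousOn_speed {A B : PosDefMatrix 𝕜 m}
    {γ γ' : ℝ → Matrix (Fin m) (Fin m) 𝕜} (h : IsC1Curve A B γ γ') :
    ContinuousOn (fun t => Real.sqrt (traceInner (γ t) (γ' t) (γ' t))) (Set.Icc 0 1) := by
  have h1 : ContinuousOn (fun t => (γ t)⁻¹) (Set.Icc 0 1) := fun t ht =>
    (continuousAt_inv_of_posDef (h.posDef t ht)).comp_continuousWithinAt (h.continuousOn t ht)
  have h2 : Continuous fun K : Matrix (Fin m) (Fin m) 𝕜 => RCLike.re K.trace :=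
    RCLike.continuous_re.comp continuous_id.matrix_trace
  exact (h2.comp_continuousOn
    (((h1.mul h.continuousDeriv).mul h1).mul h.continuousDeriv)).sqrt

theorem IsC1Curve.tendsto_slope {A B : PosDefMatrix 𝕜 m}
    {γ γ' : ℝ → Matrix (Fin m) (Fin m) 𝕜} (h : IsC1Curve A B γ γ') {x : ℝ}
    (hx : x ∈ Set.Ico (0 : ℝ) 1) : Tendsto (slope γ x) (𝓝[>] x) (𝓝 (γ' x)) := by
  refine (hasDerivWithinAt_matrix_iff_tendsto_slope.1
    (h.hasDeriv x (Set.Ico_subset_Icc_self hx))).mono_left ?_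
  refine nhdsWithin_le_iff.2 ?_
  filter_upwards [Ioc_mem_nhdsGT hx.2] with z hz
  exact ⟨⟨hx.1.trans hz.1.le, hz.2⟩, hz.1.ne'⟩

/-- Taking logarithms does not increase lengths: the chord joining the logarithms of the ends is no
longer than the curve. -/
theorem IsC1Curve.norm_matrixLog_sub_le_curveLength {A B : PosDefMatrix 𝕜 m}
    {γ γ' : ℝ → Matrix (Fin m) (Fin m) 𝕜} (h : IsC1Curve A B γ γ') :
    ‖toFrobenius (matrixLog B.toMatrix) - toFrobenius (matrixLog A.toMatrix)‖ ≤
      curveLength γ γ' := by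
  set ℓ : ℝ → EuclideanSpace 𝕜 (Fin m × Fin m) := fun t => toFrobenius (matrixLog (γ t)) with hℓ
  set g : ℝ → ℝ := fun t => Real.sqrt (traceInner (γ t) (γ' t) (γ' t)) with hg
  have hgc : ContinuousOn g (Set.Icc 0 1) := h.continuousOn_speed
  have hℓc : ContinuousOn ℓ (Set.Icc 0 1) := continuousOn_matrixLog.comp h.continuousOn h.posDef
  have hgi : IntervalIntegrable g MeasureTheory.volume 0 1 :=
    ContinuousOn.intervalIntegrable (by rwa [Set.uIcc_of_le zero_le_one])
  have hfc : ContinuousOn (fun t => ‖ℓ t - ℓ 0‖) (Set.Icc 0 1) :=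
    (hℓc.sub continuousOn_const).norm
  have hBc : ContinuousOn (fun t => ∫ s in (0 : ℝ)..t, g s) (Set.Icc 0 1) := by
    have := intervalIntegral.continuousOn_primitive_interval (μ := MeasureTheory.volume) (f := g)
      (a := 0) (b := 1) (by
        rw [Set.uIcc_of_le zero_le_one]; exact hgc.integrableOn_Icc)
    rwa [Set.uIcc_of_le zero_le_one] at this
  have hmem : ∀ x ∈ Set.Ico (0 : ℝ) 1, Set.Icc (0 : ℝ) 1 ∈ 𝓝[>] x := fun x hx => by
    filter_upwards [Ioc_mem_nhdsGT hx.2] with z hz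
    exact ⟨hx.1.trans hz.1.le, hz.2⟩
  have hBd : ∀ x ∈ Set.Ico (0 : ℝ) 1,
      HasDerivWithinAt (fun t => ∫ s in (0 : ℝ)..t, g s) (g x) (Set.Ici x) x := by
    intro x hx
    have hcw : ContinuousWithinAt g (Set.Ioi x) x :=
      (hgc x (Set.Ico_subset_Icc_self hx)).mono_of_mem_nhdsWithin (hmem x hx)
    refine intervalIntegral.integral_hasDerivWithinAt_right (hgi.mono_set ?_) ?_ hcw
    · rw [Set.uIcc_of_le hx.1, Set.uIcc_of_le zero_le_one]
      exact Set.Icc_subset_Icc_right hx.2.le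
    · exact ⟨_, hmem x hx, hgc.aestronglyMeasurable measurableSet_Icc⟩
  -- the squared slope of `t ↦ ‖ℓ t - ℓ 0‖` between `x` and `z` is at most the trace form of the
  -- slope of `γ`, with one of the two inverses taken at `x` and the other one at `z`;
  -- let `z` tend to `x`
  have hbound : ∀ x ∈ Set.Ico (0 : ℝ) 1, ∀ r, g x < r →
      ∃ᶠ z in 𝓝[>] x, slope (fun t => ‖ℓ t - ℓ 0‖) x z < r := by
    intro x hx r hr
    have hx' := Set.Ico_subset_Icc_self hx
    have hslope := h.tendsto_slope hx
    have hγ : Tendsto γ (𝓝[>] x) (𝓝 (γ x)) :=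
      (h.continuousOn x hx').mono_of_mem_nhdsWithin (hmem x hx)
    have hinv : Tendsto (fun z => (γ z)⁻¹) (𝓝[>] x) (𝓝 (γ x)⁻¹) :=
      (continuousAt_inv_of_posDef (h.posDef x hx')).tendsto.comp hγ
    have htr : Continuous fun K : Matrix (Fin m) (Fin m) 𝕜 => RCLike.re K.trace :=
      RCLike.continuous_re.comp continuous_id.matrix_trace
    have hlim : Tendsto (fun z => Real.sqrt (RCLike.re
        ((γ x)⁻¹ * slope γ x z * (γ z)⁻¹ * slope γ x z).trace)) (𝓝[>] x) (𝓝 (g x)) :=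
      ((htr.tendsto _).comp (((hslope.const_mul _).mul hinv).mul hslope)).sqrt
    refine Eventually.frequently ?_
    filter_upwards [hlim.eventually_lt_const hr, Ioc_mem_nhdsGT hx.2] with z hz hxz
    refine lt_of_le_of_lt ?_ hz
    have hpos : 0 < z - x := sub_pos.2 hxz.1
    refine Real.le_sqrt_of_sq_le ?_
    have h1 : (‖ℓ z - ℓ 0‖ - ‖ℓ x - ℓ 0‖) ^ 2 ≤ ‖ℓ z - ℓ x‖ ^ 2 := by
      refine sq_le_sq.2 ((abs_norm_sub_norm_le _ _).trans ?_)
      rw [sub_sub_sub_cancel_right, abs_norm]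
    have h2 := h1.trans (norm_sq_matrixLog_sub_le (h.posDef x hx')
      (h.posDef z ⟨hx.1.trans hxz.1.le, hxz.2⟩))
    simp only [slope_def_module, smul_eq_mul, mul_smul_comm, smul_mul_assoc, Matrix.trace_smul,
      RCLike.smul_re]
    rw [mul_pow, ← mul_assoc, ← sq]
    exact mul_le_mul_of_nonneg_left h2 (by positivity)
  have hmain := image_le_of_liminf_slope_right_le_deriv_boundary hfc (by simp) hBc hBd hbound
    (Set.right_mem_Icc.2 zero_le_one)
  simp only [hℓ, h.source, h.target] at hmain
  exact hmain

theorem curveLength_nonneg (γ γ' : ℝ → Matrix (Fin m) (Fin m) 𝕜) : 0 ≤ curveLength γ γ' :=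
  intervalIntegral.integral_nonneg zero_le_one fun _ _ => Real.sqrt_nonneg _

theorem traceDist_le_curveLength {A B : PosDefMatrix 𝕜 m}
    {γ γ' : ℝ → Matrix (Fin m) (Fin m) 𝕜} (h : IsC1Curve A B γ γ') :
    traceDist A B ≤ curveLength γ γ' :=
  csInf_le ⟨0, by rintro _ ⟨γ, γ', -, rfl⟩; exact curveLength_nonneg γ γ'⟩ ⟨γ, γ', h, rfl⟩

/-- Two matrices with a common eigenbasis are joined by the curve along which the logarithms of the
eigenvalues are affine functions. -/
theorem exists_isC1Curve_of_spectralForm {A B : PosDefMatrix 𝕜 m}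
    (U : Matrix.unitaryGroup (Fin m) 𝕜) {a b : Fin m → ℝ} (ha : ∀ i, 0 < a i)
    (hb : ∀ i, 0 < b i) (hA : A.toMatrix = spectralForm U a) (hB : B.toMatrix = spectralForm U b) :
    ∃ γ γ' : ℝ → Matrix (Fin m) (Fin m) 𝕜, IsC1Curve A B γ γ' ∧ curveLength γ γ' =
      ‖toFrobenius (matrixLog B.toMatrix) - toFrobenius (matrixLog A.toMatrix)‖ := by
  set c : Fin m → ℝ := fun i => Real.log (b i) - Real.log (a i) with hc
  let e : ℝ → Fin m → ℝ := fun t i => Real.exp (Real.log (a i) + t * c i)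
  have he : ∀ t i, e t i ≠ 0 := fun t i => (Real.exp_pos _).ne'
  refine ⟨fun t => spectralForm U (e t), fun t => spectralForm U (fun i => e t i * c i),
    ⟨?_, ?_, fun t _ => posDef_spectralForm U fun i => Real.exp_pos _, fun t _ => ?_, ?_⟩, ?_⟩
  · simp only [hA, e, zero_mul, add_zero, Real.exp_log (ha _)]
  · simp only [hB, e, hc, one_mul, add_sub_cancel, Real.exp_log (hb _)]
  · refine hasDerivWithinAt_spectralForm U fun i => ?_
    have h1 : HasDerivAt (fun t => Real.log (a i) + t * c i) (c i) t := by
      simpa using ((hasDerivAt_id t).mul_const (c i)).const_add (Real.log (a i))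
    exact h1.exp.hasDerivWithinAt
  · exact ((continuous_spectralForm U).comp (by fun_prop)).continuousOn
  · have hlog : toFrobenius (matrixLog B.toMatrix) - toFrobenius (matrixLog A.toMatrix) =
        toFrobenius (spectralForm U c) := by
      rw [hA, hB, matrixLog_spectralForm, matrixLog_spectralForm, ← toFrobenius_sub,
        spectralForm_sub]
    have hspeed : ∀ t, Real.sqrt (traceInner (spectralForm U (e t))
        (spectralForm U fun i => e t i * c i) (spectralForm U fun i => e t i * c i)) =
        ‖toFrobenius (spectralForm U c)‖ := fun t => by
      have h1 : (fun i => (e t i)⁻¹ * (e t i * c i)) = c := funext fun i => by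
        rw [inv_mul_cancel_left₀ (he t i)]
      rw [traceInner, spectralForm_inv U (he t), mul_assoc _ (spectralForm U fun i => (e t i)⁻¹),
        spectralForm_mul, h1, ← Real.sqrt_sq (norm_nonneg _), norm_sq_toFrobenius_eq_trace,
        (show star (spectralForm U c) = spectralForm U c from isHermitian_spectralForm U c)]
    simp only [curveLength, hspeed, hlog]
    simp

/-- The congruence `A ↦ S A S`. -/
def PosDefMatrix.congr (S A : PosDefMatrix 𝕜 m) : PosDefMatrix 𝕜 m :=
  ⟨S.toMatrix * A.toMatrix * S.toMatrix, posDef_conj S.posDef A.posDef⟩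

theorem PosDefMatrix.isUnit_det (S : PosDefMatrix 𝕜 m) : IsUnit S.toMatrix.det :=
  (Matrix.isUnit_iff_isUnit_det _).1 S.posDef.isUnit

/-- The inverse of a positive definite matrix. -/
noncomputable def PosDefMatrix.inverse (S : PosDefMatrix 𝕜 m) : PosDefMatrix 𝕜 m :=
  ⟨S.toMatrix⁻¹, S.posDef.inv⟩

theorem PosDefMatrix.congr_inverse_congr (S A : PosDefMatrix 𝕜 m) :
    S.inverse.congr (S.congr A) = A := by
  refine Subtype.ext ?_
  have h1 := Matrix.nonsing_inv_mul _ S.isUnit_det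
  have h2 := Matrix.mul_nonsing_inv _ S.isUnit_det
  calc S.toMatrix⁻¹ * (S.toMatrix * A.toMatrix * S.toMatrix) * S.toMatrix⁻¹
      = (S.toMatrix⁻¹ * S.toMatrix) * A.toMatrix * (S.toMatrix * S.toMatrix⁻¹) := by
        simp only [mul_assoc]
    _ = A.1 := by rw [h1, h2, one_mul, mul_one]; rfl

theorem traceInner_congr (S : PosDefMatrix 𝕜 m) (P H K : Matrix (Fin m) (Fin m) 𝕜) :
    traceInner (S.toMatrix * P * S.toMatrix) (S.toMatrix * H * S.toMatrix)
      (S.toMatrix * K * S.toMatrix) = traceInner P H K := by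
  set T := S.toMatrix
  have h1 : T⁻¹ * T = 1 := Matrix.nonsing_inv_mul _ S.isUnit_det
  have h2 : T * T⁻¹ = 1 := Matrix.mul_nonsing_inv _ S.isUnit_det
  have h3 : (T * P * T)⁻¹ * (T * H * T) * (T * P * T)⁻¹ * (T * K * T) =
      T⁻¹ * (P⁻¹ * H * P⁻¹ * K * T) := by
    calc _ = T⁻¹ * (P⁻¹ * (T⁻¹ * T) * H * (T * T⁻¹) * P⁻¹ * (T⁻¹ * T) * K * T) := by
          simp only [Matrix.mul_inv_rev, mul_assoc]
      _ = _ := by rw [h1, h2]; simp only [mul_one]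
  rw [traceInner, h3, Matrix.trace_mul_comm, mul_assoc, h2, mul_one, traceInner]

theorem IsC1Curve.congr {A B : PosDefMatrix 𝕜 m} {γ γ' : ℝ → Matrix (Fin m) (Fin m) 𝕜}
    (h : IsC1Curve A B γ γ') (S : PosDefMatrix 𝕜 m) :
    IsC1Curve (S.congr A) (S.congr B) (fun t => S.toMatrix * γ t * S.toMatrix)
      (fun t => S.toMatrix * γ' t * S.toMatrix) where
  source := by rw [h.source]; rfl
  target := by rw [h.target]; rfl
  posDef t ht := posDef_conj S.posDef (h.posDef t ht)
  hasDeriv t ht := hasDerivWithinAt_const_mul_mul_const (h.hasDeriv t ht) _ _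
  continuousDeriv := (continuousOn_const.mul h.continuousDeriv).mul continuousOn_const

/-- Congruences are isometries, since they preserve the lengths of curves. -/
theorem traceDist_congr (S A B : PosDefMatrix 𝕜 m) :
    traceDist (S.congr A) (S.congr B) = traceDist A B := by
  have hsub : ∀ S A B : PosDefMatrix 𝕜 m, ∀ L : ℝ,
      (∃ γ γ' : ℝ → Matrix (Fin m) (Fin m) 𝕜, IsC1Curve A B γ γ' ∧ L = curveLength γ γ') →
      ∃ γ γ' : ℝ → Matrix (Fin m) (Fin m) 𝕜,
        IsC1Curve (S.congr A) (S.congr B) γ γ' ∧ L = curveLength γ γ' := by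
    rintro S A B _ ⟨γ, γ', h, rfl⟩
    refine ⟨_, _, h.congr S, ?_⟩
    simp only [curveLength, traceInner_congr]
  refine congrArg sInf (Set.ext fun L => ⟨fun h => ?_, hsub S A B L⟩)
  have h1 := hsub S.inverse _ _ L h
  rw [PosDefMatrix.congr_inverse_congr, PosDefMatrix.congr_inverse_congr] at h1
  exact h1

end Curves

/-! ### The trace distance -/

section TraceDist

variable {𝕜 : Type*} [RCLike 𝕜] {m : ℕ}

/-- The logarithm of a positive definite matrix, as a vector of a Euclidean space. -/
noncomputable def logVec (A : PosDefMatrix 𝕜 m) : EuclideanSpace 𝕜 (Fin m × Fin m) :=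
  toFrobenius (matrixLog A.toMatrix)

/-- The identity matrix. -/
def PosDefMatrix.one : PosDefMatrix 𝕜 m := ⟨1, Matrix.PosDef.one⟩

theorem logVec_one : logVec (PosDefMatrix.one : PosDefMatrix 𝕜 m) = 0 := by
  have h : (PosDefMatrix.one : PosDefMatrix 𝕜 m).toMatrix = 1 := rfl
  rw [logVec, h, matrixLog_one]
  rfl

theorem logVec_inverse (A : PosDefMatrix 𝕜 m) : logVec A.inverse = -logVec A := by
  have h : A.inverse.toMatrix = A.toMatrix⁻¹ := rfl
  rw [logVec, h, matrixLog_inv A.posDef, toFrobenius_neg]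
  rfl

theorem logVec_injective : Function.Injective (logVec : PosDefMatrix 𝕜 m → _) := fun A B h => by
  refine Subtype.ext ?_
  have h1 := exp_matrixLog A.posDef
  rw [toFrobenius_injective h, exp_matrixLog B.posDef] at h1
  exact h1.symm

/-- The inverse square root of a positive definite matrix. -/
noncomputable def PosDefMatrix.invSqrt (A : PosDefMatrix 𝕜 m) : PosDefMatrix 𝕜 m :=
  ⟨(CFC.sqrt A.toMatrix)⁻¹, (posDef_sqrt A.posDef).inv⟩

theorem invSqrt_congr_self (A : PosDefMatrix 𝕜 m) : A.invSqrt.congr A = PosDefMatrix.one := by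
  refine Subtype.ext ?_
  have h1 : CFC.sqrt A.toMatrix * CFC.sqrt A.toMatrix = A.toMatrix :=
    CFC.sqrt_mul_sqrt_self _ A.posDef.posSemidef.nonneg
  have h2 := (Matrix.isUnit_iff_isUnit_det _).1 (posDef_sqrt A.posDef).isUnit
  change (CFC.sqrt A.toMatrix)⁻¹ * A.toMatrix * (CFC.sqrt A.toMatrix)⁻¹ = 1
  nth_rewrite 2 [← h1]
  rw [Matrix.nonsing_inv_mul_cancel_left _ _ h2, Matrix.mul_nonsing_inv _ h2]

theorem traceDist_le_norm_of_spectralForm {A B : PosDefMatrix 𝕜 m}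
    (U : Matrix.unitaryGroup (Fin m) 𝕜) {a b : Fin m → ℝ} (ha : ∀ i, 0 < a i)
    (hb : ∀ i, 0 < b i) (hA : A.toMatrix = spectralForm U a) (hB : B.toMatrix = spectralForm U b) :
    traceDist A B ≤ ‖logVec B - logVec A‖ := by
  obtain ⟨γ, γ', h, hL⟩ := exists_isC1Curve_of_spectralForm U ha hb hA hB
  exact (traceDist_le_curveLength h).trans hL.le

theorem exists_isC1Curve (A B : PosDefMatrix 𝕜 m) :
    ∃ γ γ' : ℝ → Matrix (Fin m) (Fin m) 𝕜, IsC1Curve A B γ γ' := by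
  obtain ⟨U, b, hb, hB⟩ := exists_eq_spectralForm (A.invSqrt.congr B).posDef
  obtain ⟨γ, γ', h, -⟩ := exists_isC1Curve_of_spectralForm (A := PosDefMatrix.one) U
    (fun _ => one_pos) hb (spectralForm_one U).symm hB
  have h1 := h.congr A.invSqrt.inverse
  rw [← invSqrt_congr_self A, PosDefMatrix.congr_inverse_congr,
    PosDefMatrix.congr_inverse_congr] at h1
  exact ⟨_, _, h1⟩

/-- The exponential metric increasing property. The set of lengths has to be nonempty here, since
`sInf ∅ = 0`. -/
theorem norm_logVec_sub_le_traceDist (A B : PosDefMatrix 𝕜 m) :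
    ‖logVec B - logVec A‖ ≤ traceDist A B := by
  obtain ⟨γ, γ', h⟩ := exists_isC1Curve A B
  refine le_csInf ⟨_, γ, γ', h, rfl⟩ ?_
  rintro _ ⟨γ, γ', h, rfl⟩
  exact h.norm_matrixLog_sub_le_curveLength

theorem traceDist_one_left (A : PosDefMatrix 𝕜 m) :
    traceDist PosDefMatrix.one A = ‖logVec A‖ := by
  obtain ⟨U, a, ha, hA⟩ := exists_eq_spectralForm A.posDef
  refine le_antisymm ?_ ?_
  · simpa only [logVec_one, sub_zero] using traceDist_le_norm_of_spectralForm
      (A := PosDefMatrix.one) U (fun _ => one_pos) ha (spectralForm_one U).symm hA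
  · simpa only [logVec_one, sub_zero] using norm_logVec_sub_le_traceDist PosDefMatrix.one A

theorem traceDist_one_right (A : PosDefMatrix 𝕜 m) :
    traceDist A PosDefMatrix.one = ‖logVec A‖ := by
  obtain ⟨U, a, ha, hA⟩ := exists_eq_spectralForm A.posDef
  refine le_antisymm ?_ ?_
  · simpa only [logVec_one, zero_sub, norm_neg] using traceDist_le_norm_of_spectralForm
      (B := PosDefMatrix.one) U ha (fun _ => one_pos) hA (spectralForm_one U).symm
  · simpa only [logVec_one, zero_sub, norm_neg] using
      norm_logVec_sub_le_traceDist A PosDefMatrix.one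

theorem traceDist_inverse_right (A : PosDefMatrix 𝕜 m) :
    traceDist A A.inverse = 2 * ‖logVec A‖ := by
  obtain ⟨U, a, ha, hA⟩ := exists_eq_spectralForm A.posDef
  have h : ‖logVec A.inverse - logVec A‖ = 2 * ‖logVec A‖ := by
    rw [logVec_inverse, ← neg_add', norm_neg, ← two_smul ℝ, norm_smul, Real.norm_two]
  rw [← h]
  refine le_antisymm ?_ (norm_logVec_sub_le_traceDist _ _)
  refine traceDist_le_norm_of_spectralForm U ha (fun i => inv_pos.2 (ha i)) hA ?_
  rw [← spectralForm_inv U fun i => (ha i).ne', ← hA]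
  rfl

theorem traceDist_eq_norm_left (A B : PosDefMatrix 𝕜 m) :
    traceDist A B = ‖logVec (A.invSqrt.congr B)‖ := by
  rw [← traceDist_one_left, ← invSqrt_congr_self A, traceDist_congr]

theorem traceDist_eq_norm_right (A B : PosDefMatrix 𝕜 m) :
    traceDist A B = ‖logVec (B.invSqrt.congr A)‖ := by
  rw [← traceDist_one_right, ← invSqrt_congr_self B, traceDist_congr]

theorem traceDist_self (A : PosDefMatrix 𝕜 m) : traceDist A A = 0 := by
  rw [traceDist_eq_norm_left, invSqrt_congr_self, logVec_one, norm_zero]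

theorem traceDist_comm (A B : PosDefMatrix 𝕜 m) : traceDist A B = traceDist B A := by
  rw [traceDist_eq_norm_left, traceDist_eq_norm_right]

/-- A congruence carries `A` to the identity, so that the distances from `A` become norms of
logarithms; the distance of `B` and `C` is bounded below by that of their logarithms. -/
theorem traceDist_triangle (A B C : PosDefMatrix 𝕜 m) :
    traceDist A C ≤ traceDist A B + traceDist B C := by
  have h := norm_logVec_sub_le_traceDist (A.invSqrt.congr B) (A.invSqrt.congr C)
  rw [traceDist_congr] at h
  rw [traceDist_eq_norm_left A, traceDist_eq_norm_left A]
  linarith [norm_le_insert' (logVec (A.invSqrt.congr C)) (logVec (A.invSqrt.congr B))]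

theorem eq_of_traceDist_eq_zero {A B : PosDefMatrix 𝕜 m} (h : traceDist A B = 0) : A = B := by
  have h1 := norm_logVec_sub_le_traceDist A B
  rw [h] at h1
  exact (logVec_injective (sub_eq_zero.1 (norm_le_zero_iff.1 h1))).symm

variable (𝕜 m) in
/-- The positive definite matrices with the distance of the Riemannian trace metric. -/
@[reducible]
noncomputable def traceMetricSpace : MetricSpace (PosDefMatrix 𝕜 m) where
  dist := traceDist
  dist_self := traceDist_self
  dist_comm := traceDist_comm
  dist_triangle := traceDist_triangle
  eq_of_dist_eq_zero := eq_of_traceDist_eq_zero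

/-- The logarithms of a Cauchy sequence converge to a Hermitian matrix `X`, and the sequence
converges to `exp X`: by continuity of the logarithm at the identity, the distance is controlled by
the entrywise convergence. -/
theorem completeSpace_traceMetricSpace :
    @CompleteSpace (PosDefMatrix 𝕜 m) (traceMetricSpace 𝕜 m).toUniformSpace := by
  let := traceMetricSpace 𝕜 m
  refine Metric.complete_of_cauchySeq_tendsto fun u hu => ?_
  have hlip : LipschitzWith 1 (logVec : PosDefMatrix 𝕜 m → _) :=
    LipschitzWith.of_dist_le_mul fun A B => by
      rw [NNReal.coe_one, one_mul, dist_comm, dist_eq_norm]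
      exact norm_logVec_sub_le_traceDist A B
  obtain ⟨v, hv⟩ := cauchySeq_tendsto_of_complete (hlip.uniformContinuous.comp_cauchySeq hu)
  let X : Matrix (Fin m) (Fin m) 𝕜 := Matrix.of fun i j => v (i, j)
  have hX : Tendsto (fun n => matrixLog (u n).toMatrix) atTop (𝓝 X) := by
    refine tendsto_pi_nhds.2 fun i => tendsto_pi_nhds.2 fun j => ?_
    exact ((PiLp.continuous_apply 2 _ (i, j)).tendsto v).comp hv
  have hXh : X.IsHermitian := by
    refine tendsto_nhds_unique ?_ hX
    refine ((continuous_id.matrix_conjTranspose.tendsto X).comp hX).congr fun n => ?_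
    exact isHermitian_matrixLog _
  let A : PosDefMatrix 𝕜 m := ⟨NormedSpace.exp X, posDef_exp hXh⟩
  have hA : Tendsto (fun n => (u n).toMatrix) atTop (𝓝 A.toMatrix) :=
    ((continuous_matrix_exp.tendsto X).comp hX).congr fun n => exp_matrixLog (u n).posDef
  refine ⟨A, tendsto_iff_dist_tendsto_zero.2 ?_⟩
  have hcongr : Tendsto (fun n => (A.invSqrt.congr (u n)).toMatrix) atTop
      (𝓝 (A.invSqrt.congr A).toMatrix) := (hA.const_mul _).mul_const _
  have hlog : Tendsto (fun n => logVec (A.invSqrt.congr (u n))) atTop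
      (𝓝 (logVec (A.invSqrt.congr A))) := by
    refine (continuousOn_matrixLog _ (A.invSqrt.congr A).posDef).tendsto.comp ?_
    exact tendsto_nhdsWithin_iff.2 ⟨hcongr, Eventually.of_forall fun n => PosDefMatrix.posDef _⟩
  rw [invSqrt_congr_self, logVec_one] at hlog
  refine (norm_zero (E := EuclideanSpace 𝕜 (Fin m × Fin m)) ▸ hlog.norm).congr fun n => ?_
  rw [dist_comm]
  exact (traceDist_eq_norm_left A (u n)).symm

/-! ### The geometric mean as a midpoint -/

/-- `M = A # B` solves the Riccati equation `M A⁻¹ M = B`. -/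
theorem geomMean_mul_inv_mul (A B : PosDefMatrix 𝕜 m) :
    (geomMean A B).toMatrix * A.toMatrix⁻¹ * (geomMean A B).toMatrix = B.toMatrix := by
  set R := CFC.sqrt A.toMatrix with hR
  set Q := CFC.sqrt (R⁻¹ * B.toMatrix * R⁻¹) with hQ
  have hM : (geomMean A B).toMatrix = R * Q * R := rfl
  have hRR : R * R = A.toMatrix := CFC.sqrt_mul_sqrt_self _ A.posDef.posSemidef.nonneg
  have hQQ : Q * Q = R⁻¹ * B.toMatrix * R⁻¹ := CFC.sqrt_mul_sqrt_self _
    (posDef_conj (posDef_sqrt A.posDef).inv B.posDef).posSemidef.nonneg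
  have hu := (Matrix.isUnit_iff_isUnit_det _).1 (posDef_sqrt A.posDef).isUnit
  have h1 : R⁻¹ * R = 1 := Matrix.nonsing_inv_mul _ hu
  have h2 : R * R⁻¹ = 1 := Matrix.mul_nonsing_inv _ hu
  rw [hM, ← hRR, Matrix.mul_inv_rev]
  calc R * Q * R * (R⁻¹ * R⁻¹) * (R * Q * R)
      = R * Q * (R * R⁻¹) * (R⁻¹ * R) * Q * R := by simp only [mul_assoc]
    _ = R * (Q * Q) * R := by rw [h1, h2]; simp only [mul_one, mul_assoc]
    _ = (R * R⁻¹) * B.toMatrix * (R⁻¹ * R) := by rw [hQQ]; simp only [mul_assoc]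
    _ = B.toMatrix := by rw [h1, h2, one_mul, mul_one]

/-- The congruence that carries `A # B` to the identity makes `A` and `B` inverse to each other. -/
theorem invSqrt_geomMean_congr_right (A B : PosDefMatrix 𝕜 m) :
    (geomMean A B).invSqrt.congr B = ((geomMean A B).invSqrt.congr A).inverse := by
  set M := geomMean A B with hM
  have hone : M.invSqrt.toMatrix * M.toMatrix * M.invSqrt.toMatrix = 1 :=
    congrArg Subtype.val (invSqrt_congr_self M)
  set S := M.invSqrt.toMatrix with hS
  have hu : IsUnit S.det := M.invSqrt.isUnit_det
  have h1 : S⁻¹ = S * M.toMatrix := Matrix.inv_eq_left_inv hone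
  have h2 : S⁻¹ = M.toMatrix * S := Matrix.inv_eq_right_inv (by rw [← mul_assoc, hone])
  refine Subtype.ext ?_
  change S * B.toMatrix * S = (S * A.toMatrix * S)⁻¹
  rw [← geomMean_mul_inv_mul A B, ← hM, Matrix.mul_inv_rev, Matrix.mul_inv_rev]
  nth_rewrite 1 [h1]
  rw [h2]
  simp only [mul_assoc]

/-- At the identity, with `A = exp X`, `B = exp (-X)` and `C = exp Y`, the semiparallelogram law is
the parallelogram law for `X` and `Y` together with the exponential metric increasing property. -/
theorem isSemiparallelogramMidpoint_geomMean :
    letI := traceMetricSpace 𝕜 m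
    IsSemiparallelogramMidpoint (geomMean : PosDefMatrix 𝕜 m → _ → _) := by
  let := traceMetricSpace 𝕜 m
  have hAB : ∀ A B : PosDefMatrix 𝕜 m,
      dist A B = 2 * ‖logVec ((geomMean A B).invSqrt.congr A)‖ := fun A B => by
    rw [← traceDist_inverse_right, ← invSqrt_geomMean_congr_right, traceDist_congr]
    rfl
  refine ⟨fun A B => ⟨?_, ?_⟩, fun A B C => ?_⟩
  · rw [hAB A B]
    refine (traceDist_eq_norm_left (geomMean A B) _).trans ?_
    ring
  · rw [hAB A B]
    refine (traceDist_eq_norm_left (geomMean A B) _).trans ?_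
    rw [invSqrt_geomMean_congr_right, logVec_inverse, norm_neg]
    ring
  · have hMC : dist (geomMean A B) C = ‖logVec ((geomMean A B).invSqrt.congr C)‖ :=
      traceDist_eq_norm_left _ _
    have hAC := norm_logVec_sub_le_traceDist ((geomMean A B).invSqrt.congr A)
      ((geomMean A B).invSqrt.congr C)
    have hBC := norm_logVec_sub_le_traceDist ((geomMean A B).invSqrt.congr B)
      ((geomMean A B).invSqrt.congr C)
    rw [traceDist_congr] at hAC hBC
    rw [invSqrt_geomMean_congr_right, logVec_inverse, sub_neg_eq_add] at hBC
    rw [hAB A B, hMC]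
    change _ ≤ traceDist A C ^ 2 + traceDist B C ^ 2
    -- `‖Y - X‖² + ‖Y + X‖² = 2 ‖X‖² + 2 ‖Y‖²` with `d(A, B) = 2 ‖X‖` and `d(M, C) = ‖Y‖`
    have hpar := parallelogram_law_with_norm 𝕜 (logVec ((geomMean A B).invSqrt.congr C))
      (logVec ((geomMean A B).invSqrt.congr A))
    have h1 := pow_le_pow_left₀ (norm_nonneg _) hAC 2
    have h2 := pow_le_pow_left₀ (norm_nonneg _) hBC 2
    nlinarith

theorem isConvexMean_geomMean2 :
    letI := traceMetricSpace 𝕜 m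
    IsConvexMean (geomMean2 : (Fin 2 → PosDefMatrix 𝕜 m) → _) := by
  let := traceMetricSpace 𝕜 m
  have h := isSemiparallelogramMidpoint_geomMean (𝕜 := 𝕜) (m := m)
  refine ⟨completeSpace_traceMetricSpace, h.mid_self, fun π x => ?_, h.dist_mid_le⟩
  change geomMean (x (π 0)) (x (π 1)) = geomMean (x 0) (x 1)
  have hne : π 0 ≠ π 1 := π.injective.ne zero_ne_one
  rcases (show π 0 = 0 ∧ π 1 = 1 ∨ π 0 = 1 ∧ π 1 = 0 by omega) with ⟨h0, h1⟩ | ⟨h0, h1⟩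
  · rw [h0, h1]
  · rw [h0, h1, h.mid_comm]

end TraceDist

end HigherMeans

theorem corollaryC (𝕜 : Type*) [RCLike 𝕜] (m : ℕ) :
    ∃ _ : MetricSpace (HigherMeans.PosDefMatrix 𝕜 m),
      (∀ A B : HigherMeans.PosDefMatrix 𝕜 m, dist A B = HigherMeans.traceDist A B) ∧
      (∀ A B M : HigherMeans.PosDefMatrix 𝕜 m,
        HigherMeans.IsMetricMidpoint A B M ↔ M = HigherMeans.geomMean A B) ∧
      HigherMeans.IsConvexMean
        (HigherMeans.geomMean2 : (Fin 2 → HigherMeans.PosDefMatrix 𝕜 m) → _) ∧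
      ∃ ν : (n : ℕ) → (Fin n → HigherMeans.PosDefMatrix 𝕜 m) → HigherMeans.PosDefMatrix 𝕜 m,
        HigherMeans.IsInductiveBetaExtension HigherMeans.geomMean2 ν ∧
        (∀ n, 2 ≤ n →
          HigherMeans.IsTopologicalMean (ν n) ∧ HigherMeans.IsSymmetric (ν n) ∧
          HigherMeans.IsNonexpansive (ν n) ∧ HigherMeans.IsCoordContractive (1 / 2) (ν n)) ∧
        ∀ ν' : (n : ℕ) → (Fin n → HigherMeans.PosDefMatrix 𝕜 m) → HigherMeans.PosDefMatrix 𝕜 m,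
          HigherMeans.IsInductiveBetaExtension HigherMeans.geomMean2 ν' →
            ∀ n, 2 ≤ n → ν' n = ν n := by
  let := HigherMeans.traceMetricSpace 𝕜 m
  have hconv := HigherMeans.isConvexMean_geomMean2 (𝕜 := 𝕜) (m := m)
  have : CompleteSpace (HigherMeans.PosDefMatrix 𝕜 m) := hconv.1
  have : Nonempty (HigherMeans.PosDefMatrix 𝕜 m) := ⟨HigherMeans.PosDefMatrix.one⟩
  obtain ⟨ν, hν, hprop⟩ :=
    (HigherMeans.isContractiveMean_of_isConvexMean hconv).exists_isInductiveBetaExtension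
      (by norm_num) (by norm_num)
  exact ⟨HigherMeans.traceMetricSpace 𝕜 m, fun _ _ => rfl,
    HigherMeans.isSemiparallelogramMidpoint_geomMean.isMetricMidpoint_iff, hconv, ν, hν,
    fun n hn => ⟨(hprop n hn).isTopologicalMean, (hprop n hn).isSymmetric,
      (hprop n hn).isNonexpansive, (hprop n hn).isCoordContractive⟩,
    fun _ hν' n hn => hν.unique hν' n hn⟩
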